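/- **Theorem 1.3.** Let $\mathbb{N}=\{0,1,2,\dots\}$. (i) Let $m\in\{2,3\}$ and $(c,d)\in S(m)$, where $$S(3)=\{(1,1),(1,2),(2,1),(2,2),(2,4)\}\quad\text{and}\quad S(2)=S(3)\cup\{(2,3),(2,6)\}.$$ Then any $n\in\mathbb{N}$ can be written as $x^2+y^2+z^2+w^2$ with $x,y,z,w\in\mathbb{Z}$ such that $x+y+cz=dt^m$ for some $t\in\mathbb{Z}$. (ii) If any odd integer $n>2719$ can be represented by $x^2+y^2+10z^2$ with $x,y,z\in\mathbb{Z}$, then each $n\in\mathbb{N}$ can be written as $x^2+y^2+z^2+w^2$ with $x,y,z,w\in\mathbb{Z}$ and $x+3y$ the square of an integer. (iii) If any integer $n\ge 1190$ not divisible by $16$ can be written as $x^2+10y^2+(2z^2+5^3r^4)/7$ with $r\in\{0,1,2,3\}$ and $x,y,z\in\mathbb{Z}$, then any $n\in\mathbb{N}$ can be written as $x^2+y^2+z^2+w^2$ with $x,y,z,w\in\mathbb{Z}$ and $x+3y+5z$ the square of an integer. -/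

import Mathlib

/-- The sets `S(2)` and `S(3)` of admissible pairs `(c, d)`; for all other `m` the set is
empty (only `m = 2` and `m = 3` are used). -/
def admissiblePairs : ℕ → Set (ℤ × ℤ)
  | 2 => {(1, 1), (1, 2), (2, 1), (2, 2), (2, 4)} ∪ {(2, 3), (2, 6)}
  | 3 => {(1, 1), (1, 2), (2, 1), (2, 2), (2, 4)}
  | _ => ∅

/-!
For `c ∈ {1, 2}`, an orthogonal change of variables shows that `n` is a sum of four squares with
`x + y + c z = s` as soon as `3 c n - s²` is a sum of three squares. By Legendre's theorem `s = 0`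
works unless `3 c n = 4 ^ k (8 l + 7)`, that is, unless `n = c 4 ^ k (8 l + 5)`, where one may
assume `k < m` by scaling. Then `3 c n - s²` is a power of `4` times a number congruent to `3`
or `6` modulo `8` whenever `s` is small and its `2`-part is within a factor `2` of that of
`2 ^ k c`; for the pairs in `S(m)` some `s = d t ^ m` qualifies.

Legendre's theorem follows from the fact that every positive definite integral ternary form of
determinant `1` is equivalent to `x² + y² + z²`: if `d n - 1` divides `x² + d`, then `n` is
represented by such a form, and Dirichlet's theorem on primes in arithmetic progressions together
with quadratic reciprocity supplies suitable `d` and `x`.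

In the same way, `2 n` is a sum of four squares with `x + 3 y = 2 s` if `5 n - s²` is a sum of three
squares, which settles even numbers in part (ii). The conjectural representations supply the large
odd numbers there, and all large numbers in part (iii), through the identities
`x² + y² + 10 z² = (3 z)² + (-z)² + x² + y²` and
`7 ((3 y + u)² + (3 u - y)² + v² + x²) = 7 (x² + 10 y²) + 2 (5 u - v)² + 5 (2 u + v)²`, the latter
with `2 u + v = 5 r²`.
-/

/-! ### Ternary forms of determinant one -/

/-- `n` is a sum of three squares of integers. -/
def IsSumThreeSq (n : ℤ) : Prop := ∃ x y z : ℤ, n = x ^ 2 + y ^ 2 + z ^ 2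

/-- The integral ternary quadratic form `a x² + b y² + c z² + 2 d y z + 2 e x z + 2 f x y`, given by
the entries of its Gram matrix `!![a, f, e; f, b, d; e, d, c]`. -/
structure TernaryForm where
  (a b c d e f : ℤ)

namespace TernaryForm

/-- The set of integers represented by a ternary form. -/
def values (q : TernaryForm) : Set ℤ :=
  {n | ∃ x y z : ℤ, n = q.a * x ^ 2 + q.b * y ^ 2 + q.c * z ^ 2 + 2 * q.d * (y * z)
    + 2 * q.e * (x * z) + 2 * q.f * (x * y)}

/-- The second leading principal minor of the Gram matrix. -/
def minor (q : TernaryForm) : ℤ := q.a * q.b - q.f ^ 2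

/-- The determinant of the Gram matrix. -/
def det (q : TernaryForm) : ℤ :=
  q.a * q.b * q.c + 2 * q.d * q.e * q.f - q.a * q.d ^ 2 - q.b * q.e ^ 2 - q.c * q.f ^ 2

/-- Positive definiteness, encoded by Sylvester's criterion. -/
structure IsPosDef (q : TernaryForm) : Prop where
  a_pos : 0 < q.a
  minor_pos : 0 < q.minor
  det_pos : 0 < q.det

/-- A reduction condition on ternary forms in the style of Gauss and Seeber. In the third
inequality, `a * d - e * f` is up to sign the `(y, z)` entry of the adjugate. -/
structure IsReduced (q : TernaryForm) : Prop where
  two_mul_f_le : |2 * q.f| ≤ q.a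
  two_mul_e_le : |2 * q.e| ≤ q.a
  two_mul_adj_le : |2 * (q.a * q.d - q.e * q.f)| ≤ q.minor
  a_le_b : q.a ≤ q.b
  minor_le : q.minor ≤ q.a * q.c - q.e ^ 2

/-- The form obtained by exchanging the variables `x` and `y`. -/
def swapXY (q : TernaryForm) : TernaryForm := ⟨q.b, q.a, q.c, q.e, q.d, q.f⟩

/-- The form obtained by exchanging the variables `y` and `z`. -/
def swapYZ (q : TernaryForm) : TernaryForm := ⟨q.a, q.c, q.b, q.d, q.f, q.e⟩

/-- The form obtained by the unitriangular substitution
`(x, y, z) ↦ (x + r * y + s * z, y + t * z, z)`. -/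
def shear (q : TernaryForm) (r s t : ℤ) : TernaryForm where
  a := q.a
  b := q.b + 2 * r * q.f + r ^ 2 * q.a
  c := q.c + s ^ 2 * q.a + t ^ 2 * q.b + 2 * t * q.d + 2 * s * q.e + 2 * s * t * q.f
  d := q.d + r * s * q.a + r * t * q.f + r * q.e + s * q.f + t * q.b
  e := q.e + s * q.a + t * q.f
  f := q.f + r * q.a

variable {q : TernaryForm}

theorem values_swapXY : q.swapXY.values = q.values := by
  ext n
  constructor
  all_goals
    rintro ⟨x, y, z, rfl⟩
    exact ⟨y, x, z, by simp only [swapXY]; ring⟩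

theorem values_swapYZ : q.swapYZ.values = q.values := by
  ext n
  constructor
  all_goals
    rintro ⟨x, y, z, rfl⟩
    exact ⟨x, z, y, by simp only [swapYZ]; ring⟩

theorem values_shear (r s t : ℤ) : (q.shear r s t).values = q.values := by
  ext n
  constructor
  · rintro ⟨x, y, z, rfl⟩
    exact ⟨x + r * y + s * z, y + t * z, z, by simp only [shear]; ring⟩
  · rintro ⟨x, y, z, rfl⟩
    exact ⟨x - r * (y - t * z) - s * z, y - t * z, z, by simp only [shear]; ring⟩

theorem det_swapXY : q.swapXY.det = q.det := by
  simp only [det, swapXY]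
  ring

theorem det_swapYZ : q.swapYZ.det = q.det := by
  simp only [det, swapYZ]
  ring

theorem det_shear (r s t : ℤ) : (q.shear r s t).det = q.det := by
  simp only [det, shear]
  ring

theorem minor_swapXY : q.swapXY.minor = q.minor := by
  simp only [minor, swapXY]
  ring

theorem minor_shear (r s t : ℤ) : (q.shear r s t).minor = q.minor := by
  simp only [minor, shear]
  ring

/-- An instance of Jacobi's identity for the minors of the adjugate. -/
theorem minor_mul_minor_swapYZ :
    q.minor * q.swapYZ.minor = q.a * q.det + (q.a * q.d - q.e * q.f) ^ 2 := by
  simp only [minor, det, swapYZ]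
  ring

theorem IsPosDef.b_pos (hq : q.IsPosDef) : 0 < q.b := by
  have := hq.minor_pos
  rw [minor] at this
  exact pos_of_mul_pos_right (by linarith [sq_nonneg q.f]) hq.a_pos.le

theorem IsPosDef.swapXY (hq : q.IsPosDef) : q.swapXY.IsPosDef :=
  ⟨hq.b_pos, minor_swapXY ▸ hq.minor_pos, det_swapXY ▸ hq.det_pos⟩

theorem IsPosDef.swapYZ (hq : q.IsPosDef) : q.swapYZ.IsPosDef := by
  refine ⟨hq.a_pos, pos_of_mul_pos_right ?_ hq.minor_pos.le, det_swapYZ ▸ hq.det_pos⟩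
  rw [minor_mul_minor_swapYZ]
  exact add_pos_of_pos_of_nonneg (mul_pos hq.a_pos hq.det_pos) (sq_nonneg _)

theorem IsPosDef.shear (hq : q.IsPosDef) (r s t : ℤ) : (q.shear r s t).IsPosDef :=
  ⟨hq.a_pos, (minor_shear r s t).symm ▸ hq.minor_pos, (det_shear r s t).symm ▸ hq.det_pos⟩

end TernaryForm

theorem exists_abs_two_mul_add_mul_le {a : ℤ} (ha : 0 < a) (f : ℤ) :
    ∃ t : ℤ, |2 * (f + t * a)| ≤ a := by
  refine ⟨-((2 * f + a) / (2 * a)), ?_⟩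
  have hdiv := Int.mul_ediv_add_emod (2 * f + a) (2 * a)
  have hnonneg := Int.emod_nonneg (2 * f + a) (by omega : 2 * a ≠ 0)
  have hlt := Int.emod_lt_of_pos (2 * f + a) (by omega : 0 < 2 * a)
  rw [abs_le]
  constructor <;> linarith

namespace TernaryForm

variable {q : TernaryForm}

theorem IsPosDef.exists_shear_size_reduced (hq : q.IsPosDef) : ∃ r s t : ℤ,
    |2 * (q.shear r s t).f| ≤ q.a ∧ |2 * (q.shear r s t).e| ≤ q.a ∧
      |2 * (q.a * (q.shear r s t).d - (q.shear r s t).e * (q.shear r s t).f)| ≤ q.minor := by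
  obtain ⟨t, ht⟩ := exists_abs_two_mul_add_mul_le hq.minor_pos (q.a * q.d - q.e * q.f)
  obtain ⟨r, hr⟩ := exists_abs_two_mul_add_mul_le hq.a_pos q.f
  obtain ⟨s, hs⟩ := exists_abs_two_mul_add_mul_le hq.a_pos (q.e + t * q.f)
  refine ⟨r, s, t, hr, ?_, ?_⟩
  · convert hs using 3
    simp only [TernaryForm.shear]
    ring
  · convert ht using 3
    simp only [TernaryForm.shear, minor]
    ring

/-- Shearing fixes `a` and the leading minor, and each exchange of variables lowers one of them and
fixes the other, so the reduction terminates. -/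
theorem IsPosDef.exists_isReduced (hq : q.IsPosDef) : ∃ r : TernaryForm,
    r.IsPosDef ∧ r.IsReduced ∧ r.det = q.det ∧ r.values = q.values := by
  induction hN : (q.a + q.minor).toNat using Nat.strong_induction_on generalizing q with
  | _ N ih =>
  subst hN
  have ha := hq.a_pos
  have hg := hq.minor_pos
  obtain ⟨r, s, t, hf, he, hd⟩ := hq.exists_shear_size_reduced
  set p := q.shear r s t
  have hpos : p.IsPosDef := hq.shear r s t
  have hpa : p.a = q.a := rfl
  have hpg : p.minor = q.minor := minor_shear r s t
  have hpd : p.det = q.det := det_shear r s t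
  have hpv : p.values = q.values := values_shear r s t
  rcases lt_or_ge p.b p.a with hb | hab
  · have hlt : (p.swapXY.a + p.swapXY.minor).toNat < (q.a + q.minor).toNat := by
      rw [minor_swapXY, show p.swapXY.a = p.b from rfl]
      omega
    obtain ⟨p', hp', hred, hdet, hval⟩ := ih _ hlt hpos.swapXY rfl
    exact ⟨p', hp', hred, by rw [hdet, det_swapXY, hpd], by rw [hval, values_swapXY, hpv]⟩
  rcases lt_or_ge p.swapYZ.minor p.minor with hc | hgc
  · have hlt : (p.swapYZ.a + p.swapYZ.minor).toNat < (q.a + q.minor).toNat := by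
      rw [show p.swapYZ.a = p.a from rfl]
      omega
    obtain ⟨p', hp', hred, hdet, hval⟩ := ih _ hlt hpos.swapYZ rfl
    exact ⟨p', hp', hred, by rw [hdet, det_swapYZ, hpd], by rw [hval, values_swapYZ, hpv]⟩
  exact ⟨p, hpos, ⟨hf, he, hpg ▸ hd, hab, hgc⟩, hpd, hpv⟩

theorem IsReduced.three_mul_sq_a_le (hr : q.IsReduced) (hq : q.IsPosDef) :
    3 * q.a ^ 2 ≤ 4 * q.minor := by
  have hf : (2 * q.f) ^ 2 ≤ q.a ^ 2 := sq_le_sq.2 (hr.two_mul_f_le.trans (le_abs_self _))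
  have hab : q.a * q.a ≤ q.a * q.b := mul_le_mul_of_nonneg_left hr.a_le_b hq.a_pos.le
  rw [minor]
  linarith

theorem IsReduced.three_mul_sq_minor_le (hr : q.IsReduced) (hq : q.IsPosDef) :
    3 * q.minor ^ 2 ≤ 4 * (q.a * q.det) := by
  have hd : (2 * (q.a * q.d - q.e * q.f)) ^ 2 ≤ q.minor ^ 2 :=
    sq_le_sq.2 (hr.two_mul_adj_le.trans (le_abs_self _))
  have hg : q.minor * q.minor ≤ q.minor * q.swapYZ.minor :=
    mul_le_mul_of_nonneg_left hr.minor_le hq.minor_pos.le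
  rw [minor_mul_minor_swapYZ] at hg
  linarith

theorem IsReduced.eq_of_det_eq_one (hr : q.IsReduced) (hq : q.IsPosDef) (hdet : q.det = 1) :
    q = ⟨1, 1, 1, 0, 0, 0⟩ := by
  have ha := hq.a_pos
  have hg := hq.minor_pos
  have hag := hr.three_mul_sq_a_le hq
  have hga := hr.three_mul_sq_minor_le hq
  rw [hdet, mul_one] at hga
  obtain ⟨ha1, hg1⟩ : q.a = 1 ∧ q.minor = 1 := by
    rcases le_total q.a q.minor with h | h
    · have : q.minor < 2 := by nlinarith
      omega
    · have : q.a < 2 := by nlinarith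
      omega
  obtain ⟨hf, he, hd, -, -⟩ := hr
  rw [ha1] at hf he hd
  rw [hg1] at hd
  have hf0 : q.f = 0 := by rw [abs_le] at hf; omega
  have he0 : q.e = 0 := by rw [abs_le] at he; omega
  have hd0 : q.d = 0 := by rw [he0, zero_mul, abs_le] at hd; omega
  obtain ⟨a, b, c, d, e, f⟩ := q
  simp only at ha1 hf0 he0 hd0
  subst ha1 hf0 he0 hd0
  obtain rfl : b = 1 := by simpa [minor] using hg1
  obtain rfl : c = 1 := by simpa [det] using hdet
  rfl

theorem IsPosDef.isSumThreeSq_of_det_eq_one (hq : q.IsPosDef) (hdet : q.det = 1) {n : ℤ}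
    (hn : n ∈ q.values) : IsSumThreeSq n := by
  obtain ⟨r, hr, hred, hrdet, hval⟩ := hq.exists_isReduced
  rw [← hval, hred.eq_of_det_eq_one hr (hrdet.trans hdet)] at hn
  obtain ⟨x, y, z, rfl⟩ := hn
  exact ⟨x, y, z, by ring⟩

end TernaryForm

theorem isSumThreeSq_of_dvd {n d x : ℤ} (hd : 0 < d) (hn : 0 < d * n - 1)
    (h : d * n - 1 ∣ x ^ 2 + d) : IsSumThreeSq n := by
  obtain ⟨k, hk⟩ := h
  let q : TernaryForm := ⟨d * n - 1, k, n, 1, 0, x⟩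
  have hminor : q.minor = d := by simp only [q, TernaryForm.minor]; linear_combination -hk
  have hdet : q.det = 1 := by simp only [q, TernaryForm.det]; linear_combination -n * hk
  have hq : q.IsPosDef := ⟨hn, hminor ▸ hd, hdet ▸ one_pos⟩
  exact hq.isSumThreeSq_of_det_eq_one hdet ⟨0, 0, 1, by simp [q]⟩

/-! ### The three-square theorem -/

theorem exists_prime_dvd_sq_add {p : ℕ} (hp : p.Prime) {d : ℤ} (h : jacobiSym (-d) p = 1) :
    ∃ x : ℤ, (p : ℤ) ∣ x ^ 2 + d := by
  have := Fact.mk hp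
  obtain ⟨y, hy⟩ := ZMod.isSquare_of_jacobiSym_eq_one h
  refine ⟨y.valMinAbs, ?_⟩
  rw [← ZMod.intCast_zmod_eq_zero_iff_dvd]
  push_cast at hy ⊢
  linear_combination -hy

theorem exists_two_mul_dvd_sq_add {p d x : ℤ} (hp : Odd p) (h : p ∣ x ^ 2 + d) :
    ∃ y : ℤ, 2 * p ∣ y ^ 2 + d := by
  refine ⟨x + p * (x + d), IsCoprime.mul_dvd (Int.isCoprime_two_left.2 hp) ?_ ?_⟩
  · rw [← even_iff_two_dvd]
    have hp' : ¬ Even p := Int.not_even_iff_odd.2 hp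
    simp only [Int.even_add, Int.even_mul, Int.even_pow, hp', ne_eq, OfNat.ofNat_ne_zero,
      not_false_eq_true, and_true, false_or]
    tauto
  · convert h.add (dvd_mul_right p (2 * x * (x + d) + p * (x + d) ^ 2)) using 1
    ring

theorem jacobiSym_neg_eq {d p : ℕ} (hd : Odd d) (hp : Odd p) (h : d % 4 = 3 ∨ p % 4 = 1) :
    jacobiSym (-d) p = jacobiSym p d := by
  rw [jacobiSym.neg _ hp]
  rcases Nat.odd_mod_four_iff.1 (Nat.odd_iff.1 hp) with hp4 | hp4
  · rw [ZMod.χ₄_nat_one_mod_four hp4, one_mul,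
      jacobiSym.quadratic_reciprocity_one_mod_four' hd hp4]
  · rw [ZMod.χ₄_nat_three_mod_four hp4,
      jacobiSym.quadratic_reciprocity_three_mod_four (by omega) hp4]
    ring

theorem jacobiSym_eq_one_of_mul_add_one_eq {k p d n : ℕ} (h : k * p + 1 = d * n)
    (hk : jacobiSym (-k) d = 1) : jacobiSym p d = 1 := by
  have hmod : (-k * p : ℤ) % d = 1 % d := by
    rw [show (-k * p : ℤ) = 1 + d * -n by zify at h; linarith, Int.add_mul_emod_self_left]
  have hmul := jacobiSym.mod_left' hmod
  rwa [jacobiSym.mul_left, hk, one_mul, jacobiSym.one_left] at hmul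

theorem isSumThreeSq_of_prime {n d p k : ℕ} (hp : p.Prime) (hk : k = 1 ∨ k = 2)
    (h : k * p + 1 = d * n) (hkd : jacobiSym (-k) d = 1) (hd : Odd d) (hp2 : Odd p)
    (hdp : d % 4 = 3 ∨ p % 4 = 1) : IsSumThreeSq n := by
  have hJ : jacobiSym (-d) p = 1 :=
    (jacobiSym_neg_eq hd hp2 hdp).trans (jacobiSym_eq_one_of_mul_add_one_eq h hkd)
  have hkp : (d * n - 1 : ℤ) = k * p := by
    zify at h
    linarith
  obtain ⟨x, hx⟩ : ∃ x : ℤ, (k * p : ℤ) ∣ x ^ 2 + d := by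
    obtain ⟨x, hx⟩ := exists_prime_dvd_sq_add hp hJ
    rcases hk with rfl | rfl
    · exact ⟨x, by simpa using hx⟩
    · exact exists_two_mul_dvd_sq_add (mod_cast hp2) hx
  have hpos : 0 < k * p := Nat.mul_pos (by omega) hp.pos
  exact isSumThreeSq_of_dvd (mod_cast hd.pos) (hkp ▸ mod_cast hpos) (hkp ▸ hx)

theorem exists_prime_mul_add_one_eq {n k c r : ℕ} (hr : Odd r) (h : k * r + 1 = c * n) :
    ∃ p v : ℕ, p.Prime ∧ p % 4 = r % 4 ∧ k * p + 1 = (4 * k * v + c) * n := by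
  have hn : n ≠ 0 := by
    rintro rfl
    simp at h
  have hrn : r.Coprime n := by
    refine Nat.isCoprime_iff_coprime.1 ⟨-k, c, ?_⟩
    zify at h
    linarith
  have hr4 : r.Coprime 4 := Nat.Coprime.pow_right 2 (Nat.coprime_two_right.2 hr)
  obtain ⟨p, hpr, hp, hpm⟩ :=
    Nat.forall_exists_prime_gt_and_modEq r (by omega) (hr4.mul_right hrn)
  obtain ⟨v, hv⟩ := (Nat.modEq_iff_dvd' hpr.le).1 hpm.symm
  obtain rfl : p = r + 4 * n * v := by omega
  refine ⟨_, v, hp, ?_, by linear_combination h⟩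
  rw [mul_assoc, Nat.add_mul_mod_self_left]

theorem isSumThreeSq_of_mod_four_eq_two {n : ℕ} (hn : n % 4 = 2) : IsSumThreeSq n := by
  obtain ⟨p, v, hp, hp4, h⟩ := exists_prime_mul_add_one_eq (n := n) (k := 1) (c := 1) (r := n - 1)
    (Nat.odd_iff.2 (by omega)) (by omega)
  have hd : Odd (4 * 1 * v + 1) := Nat.odd_iff.2 (by omega)
  refine isSumThreeSq_of_prime hp (.inl rfl) h ?_ hd (Nat.odd_iff.2 (by omega)) (by omega)
  rw [Nat.cast_one, jacobiSym.at_neg_one hd, ZMod.χ₄_nat_one_mod_four (by omega)]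

theorem jacobiSym_neg_two_eq_one {d : ℕ} (hd : d % 8 = 1 ∨ d % 8 = 3) :
    jacobiSym (-(2 : ℕ)) d = 1 := by
  rw [Nat.cast_two, jacobiSym.at_neg_two (Nat.odd_iff.2 (by omega)),
    ZMod.χ₈'_nat_eq_if_mod_eight, if_neg (by omega), if_pos hd]

theorem isSumThreeSq_of_mod_eight_eq_three {n : ℕ} (hn : n % 8 = 3) : IsSumThreeSq n := by
  obtain ⟨p, v, hp, hp4, h⟩ := exists_prime_mul_add_one_eq (n := n) (k := 2) (c := 1)
    (r := (n - 1) / 2) (Nat.odd_iff.2 (by omega)) (by omega)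
  exact isSumThreeSq_of_prime hp (.inr rfl) h (jacobiSym_neg_two_eq_one (by omega))
    (Nat.odd_iff.2 (by omega)) (Nat.odd_iff.2 (by omega)) (by omega)

theorem isSumThreeSq_of_mod_four_eq_one {n : ℕ} (hn : n % 4 = 1) : IsSumThreeSq n := by
  obtain ⟨p, v, hp, hp4, h⟩ := exists_prime_mul_add_one_eq (n := n) (k := 2) (c := 3)
    (r := (3 * n - 1) / 2) (Nat.odd_iff.2 (by omega)) (by omega)
  exact isSumThreeSq_of_prime hp (.inr rfl) h (jacobiSym_neg_two_eq_one (by omega))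
    (Nat.odd_iff.2 (by omega)) (Nat.odd_iff.2 (by omega)) (by omega)

theorem isSumThreeSq_of_emod_eight {n : ℤ} (hn : 0 ≤ n) (h4 : n % 4 ≠ 0) (h8 : n % 8 ≠ 7) :
    IsSumThreeSq n := by
  lift n to ℕ using hn
  rcases (by omega : n % 4 = 2 ∨ n % 8 = 3 ∨ n % 4 = 1) with h | h | h
  · exact isSumThreeSq_of_mod_four_eq_two h
  · exact isSumThreeSq_of_mod_eight_eq_three h
  · exact isSumThreeSq_of_mod_four_eq_one h

theorem isSumThreeSq_four_pow_mul {n : ℤ} (k : ℕ) (hn : 0 ≤ n) (h4 : n % 4 ≠ 0)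
    (h8 : n % 8 ≠ 7) : IsSumThreeSq (4 ^ k * n) := by
  obtain ⟨x, y, z, rfl⟩ := isSumThreeSq_of_emod_eight hn h4 h8
  refine ⟨2 ^ k * x, 2 ^ k * y, 2 ^ k * z, ?_⟩
  rw [show (4 : ℤ) = 2 ^ 2 by norm_num, pow_right_comm]
  ring

/-- Legendre's three-square theorem. -/
theorem isSumThreeSq_or_eq_four_pow_mul (n : ℕ) :
    IsSumThreeSq n ∨ ∃ k l : ℕ, n = 4 ^ k * (8 * l + 7) := by
  rcases eq_or_ne n 0 with rfl | hn
  · exact .inl ⟨0, 0, 0, by simp⟩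
  obtain ⟨k, m, hm, rfl⟩ := Nat.exists_eq_pow_mul_and_not_dvd hn 4 (by norm_num)
  by_cases h8 : m % 8 = 7
  · exact .inr ⟨k, m / 8, by rw [← h8, Nat.div_add_mod]⟩
  · left
    push_cast
    exact isSumThreeSq_four_pow_mul k (by positivity) (by omega) (by omega)

/-! ### Four squares with a linear condition -/

/-- `n` is a sum of four squares `x² + y² + z² + w²` subject to the linear condition
`a x + b y + c z = s`. -/
def IsSumFourSqWith (a b c s n : ℤ) : Prop :=
  ∃ x y z w : ℤ, n = x ^ 2 + y ^ 2 + z ^ 2 + w ^ 2 ∧ a * x + b * y + c * z = s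

theorem IsSumFourSqWith.mul_sq {a b c s n : ℤ} (h : IsSumFourSqWith a b c s n) (k : ℤ) :
    IsSumFourSqWith a b c (k * s) (k ^ 2 * n) := by
  obtain ⟨x, y, z, w, rfl, rfl⟩ := h
  exact ⟨k * x, k * y, k * z, k * w, by ring, by ring⟩

/-- Scaling a representation by `2 ^ m` multiplies `n` by `4 ^ m` and replaces `t` by `2 * t`, so
factors `4 ^ m` of `n` are harmless. -/
theorem exists_isSumFourSqWith_of_not_dvd {a b c d : ℤ} {m : ℕ} (hm : m ≠ 0)
    (h : ∀ n : ℕ, ¬ 4 ^ m ∣ n → ∃ t : ℤ, IsSumFourSqWith a b c (d * t ^ m) n) (n : ℕ) :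
    ∃ t : ℤ, IsSumFourSqWith a b c (d * t ^ m) n := by
  rcases eq_or_ne n 0 with rfl | hn
  · exact ⟨0, 0, 0, 0, 0, by simp, by simp [hm]⟩
  obtain ⟨e, n', hn', rfl⟩ :=
    Nat.exists_eq_pow_mul_and_not_dvd hn (4 ^ m) (Nat.one_lt_pow hm (by norm_num)).ne'
  obtain ⟨t, ht⟩ := h n' hn'
  refine ⟨2 ^ e * t, ?_⟩
  convert ht.mul_sq (2 ^ (m * e)) using 1
  · ring
  · push_cast
    rw [show (4 : ℤ) = 2 ^ 2 by norm_num]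
    simp only [← pow_mul]
    ring

theorem exists_isSumFourSqWith_sq_of_not_dvd {a b c : ℤ}
    (h : ∀ n : ℕ, ¬ 16 ∣ n → ∃ t : ℤ, IsSumFourSqWith a b c (t ^ 2) n) (n : ℕ) :
    ∃ t : ℤ, IsSumFourSqWith a b c (t ^ 2) n := by
  simpa using exists_isSumFourSqWith_of_not_dvd (d := 1) two_ne_zero (by simpa using h) n

theorem exists_sq_eq_three_dvd {s X Y Z : ℤ} (h : 3 ∣ s ^ 2 + X ^ 2 + Y ^ 2 + Z ^ 2) :
    ∃ X' Y' Z' : ℤ, (X' ^ 2 = X ^ 2 ∧ Y' ^ 2 = Y ^ 2 ∧ Z' ^ 2 = Z ^ 2) ∧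
      3 ∣ s + X' - Y' ∧ 3 ∣ s - X' - Z' := by
  have key : ∀ s X Y Z : ZMod 3, s ^ 2 + X ^ 2 + Y ^ 2 + Z ^ 2 = 0 → ∃ ε δ η : ℤˣ,
      s + (ε : ℤ) * X - (δ : ℤ) * Y = 0 ∧ s - (ε : ℤ) * X - (η : ℤ) * Z = 0 := by
    decide
  rw [← Nat.cast_ofNat, ← ZMod.intCast_zmod_eq_zero_iff_dvd] at h
  push_cast at h
  obtain ⟨ε, δ, η, h₁, h₂⟩ := key _ _ _ _ h
  refine ⟨ε * X, δ * Y, η * Z, ?_, ?_, ?_⟩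
  · simp only [mul_pow, ← Units.val_pow_eq_pow_val, Int.units_sq, Units.val_one, one_mul, and_self]
  · exact (ZMod.intCast_zmod_eq_zero_iff_dvd _ 3).1 (by exact_mod_cast h₁)
  · exact (ZMod.intCast_zmod_eq_zero_iff_dvd _ 3).1 (by exact_mod_cast h₂)

theorem isSumFourSqWith_one_one_one {n s : ℤ} (h : IsSumThreeSq (3 * n - s ^ 2)) :
    IsSumFourSqWith 1 1 1 s n := by
  obtain ⟨X₀, Y₀, Z₀, h⟩ := h
  obtain ⟨X, Y, Z, ⟨hX, hY, hZ⟩, ⟨x, hx⟩, ⟨y, hy⟩⟩ :=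
    exists_sq_eq_three_dvd (s := s) (X := X₀) (Y := Y₀) (Z := Z₀) ⟨n, by linarith⟩
  obtain rfl : Y = s + X - 3 * x := by linarith
  obtain rfl : Z = s - X - 3 * y := by linarith
  exact ⟨x, y, s - x - y, X - x + y, by linarith, by ring⟩

theorem IsSumThreeSq.exists_even_add {n s : ℤ} (h : IsSumThreeSq n) (hs : Even (n + s ^ 2)) :
    ∃ X Y Z : ℤ, n = X ^ 2 + Y ^ 2 + Z ^ 2 ∧ Even (s + X) := by
  obtain ⟨X, Y, Z, rfl⟩ := h
  by_cases hX : Even (s + X)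
  · exact ⟨X, Y, Z, rfl, hX⟩
  by_cases hY : Even (s + Y)
  · exact ⟨Y, X, Z, by ring, hY⟩
  refine ⟨Z, X, Y, by ring, ?_⟩
  simp only [Int.even_add, Int.even_pow, ne_eq, OfNat.ofNat_ne_zero, not_false_eq_true,
    and_true] at hs hX hY ⊢
  tauto

theorem isSumFourSqWith_one_one_two {n s : ℤ} (h : IsSumThreeSq (6 * n - s ^ 2)) :
    IsSumFourSqWith 1 1 2 s n := by
  obtain ⟨X₀, Y₀, Z₀, h, hsX₀⟩ := h.exists_even_add (s := s) ⟨3 * n, by ring⟩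
  obtain ⟨X, Y, Z, ⟨hX, hY, hZ⟩, ⟨a, ha⟩, ⟨b, hb⟩⟩ :=
    exists_sq_eq_three_dvd (s := s) (X := X₀) (Y := Y₀) (Z := Z₀) ⟨2 * n, by linarith⟩
  obtain ⟨u, hu⟩ : Even (s + X) := by
    rcases sq_eq_sq_iff_eq_or_eq_neg.1 hX with rfl | rfl
    · exact hsX₀
    · exact Int.even_sub.2 (Int.even_add.1 hsX₀)
  obtain rfl : X = 2 * u - s := by linarith
  obtain rfl : Y = 2 * u - 3 * a := by linarith
  obtain rfl : Z = 2 * (s - u) - 3 * b := by linarith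
  obtain ⟨z, hz⟩ : Even (a + b) := by
    have h6 : Even (6 * n) := ⟨3 * n, by ring⟩
    rw [show 6 * n = s ^ 2 + (2 * u - s) ^ 2 + (2 * u - 3 * a) ^ 2 + (2 * (s - u) - 3 * b) ^ 2 by
      linarith] at h6
    simp only [Int.even_add, Int.even_sub, Int.even_mul, Int.even_pow] at h6 ⊢
    grind
  obtain rfl : b = 2 * z - a := by linarith
  exact ⟨u - a, s - u - (2 * z - a), z, a - z, by linarith, by ring⟩

theorem isSumFourSqWith_one_one_two_pow {e : ℕ} (he : e ≤ 1) {n s : ℤ}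
    (h : IsSumThreeSq (3 * 2 ^ e * n - s ^ 2)) : IsSumFourSqWith 1 1 (2 ^ e) s n := by
  interval_cases e
  · exact isSumFourSqWith_one_one_one (by simpa using h)
  · exact isSumFourSqWith_one_one_two (by simpa using h)

/-- As odd squares are `1` modulo `8`, the difference is a power of `4` times a number congruent to
`3` or `6` modulo `8`. -/
theorem isSumThreeSq_sub_sq {i j l : ℕ} {σ : ℤ} (hσ : Odd σ) (hij : i ≤ j + 1) (hji : j ≤ i + 1)
    (h : (2 ^ i * σ) ^ 2 ≤ 15 * 4 ^ j) :
    IsSumThreeSq (4 ^ j * (3 * (8 * l + 5)) - (2 ^ i * σ) ^ 2) := by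
  obtain ⟨r, hr⟩ := Int.eight_dvd_sq_sub_one_of_odd hσ
  have hsq : (2 ^ i * σ) ^ 2 = 4 ^ i * σ ^ 2 := by
    rw [mul_pow, pow_right_comm]
    norm_num
  rw [hsq] at h ⊢
  obtain rfl | rfl | rfl : j = i ∨ j = i + 1 ∨ i = j + 1 := by omega
  · have := le_of_mul_le_mul_left (h.trans_eq (mul_comm _ _)) (by positivity)
    rw [← mul_sub]
    exact isSumThreeSq_four_pow_mul _ (by omega) (by omega) (by omega)
  · rw [pow_succ 4, mul_left_comm] at h
    have := le_of_mul_le_mul_left h (by positivity)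
    rw [pow_succ, mul_assoc, ← mul_sub]
    exact isSumThreeSq_four_pow_mul _ (by omega) (by omega) (by omega)
  · rw [pow_succ, mul_assoc] at h ⊢
    have := le_of_mul_le_mul_left (h.trans_eq (mul_comm _ _)) (by positivity)
    rw [← mul_sub]
    exact isSumThreeSq_four_pow_mul _ (by omega) (by omega) (by omega)

theorem exists_eq_two_pow_mul_four_pow_mul {e n k l : ℕ} (he : e ≤ 1)
    (h : 3 * 2 ^ e * n = 4 ^ k * (8 * l + 7)) :
    ∃ k l : ℕ, n = 2 ^ e * 4 ^ k * (8 * l + 5) := by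
  have h3 : 3 ∣ 8 * l + 7 :=
    (Nat.Coprime.pow_right k (by norm_num : Nat.Coprime 3 4)).dvd_of_dvd_mul_left
      (h ▸ dvd_mul_of_dvd_left (dvd_mul_right 3 _) n)
  obtain ⟨v, hv⟩ : ∃ v, 8 * l + 7 = 3 * (8 * v + 5) := ⟨(l - 1) / 3, by omega⟩
  rw [hv] at h
  interval_cases e
  · exact ⟨k, v, by linarith⟩
  · cases k with
    | zero => omega
    | succ k => exact ⟨k, v, by rw [pow_succ 4] at h; linarith⟩

/-- For `t = 2 ^ b`, the hypothesis says that the exponent of `2` in `2 ^ a * σ * t ^ m` can be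
chosen within `1` of `k + e`, as is needed for `n = 2 ^ e * 4 ^ k * (8 * l + 5)`. -/
theorem exists_isSumFourSqWith_two_pow {e m a : ℕ} {σ : ℤ} (he : e ≤ 1) (hm : m ≠ 0)
    (hσ : Odd σ) (h : ∀ k < m, ∃ b, a + m * b ≤ k + e + 1 ∧ k + e ≤ a + m * b + 1 ∧
      (2 ^ (a + m * b) * σ) ^ 2 ≤ 15 * 4 ^ (k + e)) (n : ℕ) :
    ∃ t : ℤ, IsSumFourSqWith 1 1 (2 ^ e) (2 ^ a * σ * t ^ m) n := by
  refine exists_isSumFourSqWith_of_not_dvd hm (fun n hn => ?_) n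
  rcases isSumThreeSq_or_eq_four_pow_mul (3 * 2 ^ e * n) with hsum | ⟨k, l, hkl⟩
  · exact ⟨0, isSumFourSqWith_one_one_two_pow he (by simpa [hm] using hsum)⟩
  obtain ⟨k, l, rfl⟩ := exists_eq_two_pow_mul_four_pow_mul he hkl
  have hk : k < m := by
    by_contra! hmk
    exact hn (dvd_mul_of_dvd_left (dvd_mul_of_dvd_right (pow_dvd_pow 4 hmk) _) _)
  obtain ⟨b, hle, hge, hsize⟩ := h k hk
  refine ⟨2 ^ b, isSumFourSqWith_one_one_two_pow he ?_⟩
  convert isSumThreeSq_sub_sq (l := l) hσ hle hge hsize using 1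
  have h4 : (4 : ℤ) ^ e = 2 ^ e * 2 ^ e := by rw [← mul_pow]; norm_num
  push_cast
  rw [pow_add 4, h4]
  ring

theorem exists_two_pow_of_mem_admissiblePairs {m : ℕ} (hm : m ∈ ({2, 3} : Set ℕ)) {c d : ℤ}
    (hcd : (c, d) ∈ admissiblePairs m) : ∃ (e a : ℕ) (σ : ℤ),
      e ≤ 1 ∧ Odd σ ∧ c = 2 ^ e ∧ d = 2 ^ a * σ ∧ ∀ k < m, ∃ b ≤ 1, a + m * b ≤ k + e + 1 ∧
        k + e ≤ a + m * b + 1 ∧ (2 ^ (a + m * b) * σ) ^ 2 ≤ 15 * 4 ^ (k + e) := by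
  rcases hm with rfl | rfl
  · rcases hcd with (h | h | h | h | h) | h | h <;> cases h
    · exact ⟨0, 0, 1, by decide⟩
    · exact ⟨0, 1, 1, by decide⟩
    · exact ⟨1, 0, 1, by decide⟩
    · exact ⟨1, 1, 1, by decide⟩
    · exact ⟨1, 2, 1, by decide⟩
    · exact ⟨1, 0, 3, by decide⟩
    · exact ⟨1, 1, 3, by decide⟩
  · rcases hcd with h | h | h | h | h <;> cases h
    · exact ⟨0, 0, 1, by decide⟩
    · exact ⟨0, 1, 1, by decide⟩
    · exact ⟨1, 0, 1, by decide⟩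
    · exact ⟨1, 1, 1, by decide⟩
    · exact ⟨1, 2, 1, by decide⟩

theorem exists_isSumFourSqWith_of_mem_admissiblePairs {m : ℕ} (hm : m ∈ ({2, 3} : Set ℕ)) {c d : ℤ}
    (hcd : (c, d) ∈ admissiblePairs m) (n : ℕ) :
    ∃ t : ℤ, IsSumFourSqWith 1 1 c (d * t ^ m) n := by
  obtain ⟨e, a, σ, he, hσ, rfl, rfl, h⟩ := exists_two_pow_of_mem_admissiblePairs hm hcd
  have hm0 : m ≠ 0 := by
    rintro rfl
    simp at hm
  exact exists_isSumFourSqWith_two_pow he hm0 hσ (fun k hk => (h k hk).imp fun _ => And.right) n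

/-! ### The conditions on `x + 3 y` and `x + 3 y + 5 z` -/

theorem exists_add_three_mul_eq_two_mul {p q : ℤ} (h : 5 ∣ p ^ 2 + q ^ 2) :
    ∃ x y : ℤ, x + 3 * y = 2 * p ∧ 2 * (p ^ 2 + q ^ 2) = 5 * (x ^ 2 + y ^ 2) := by
  have hmul : (5 : ℤ) ∣ (3 * p - q) * (3 * p + q) := by
    rw [show (3 * p - q) * (3 * p + q) = 5 * (2 * p ^ 2) - (p ^ 2 + q ^ 2) by ring]
    exact (dvd_mul_right 5 _).sub h
  rcases Int.Prime.dvd_mul' (p := 5) (by norm_num) hmul with ⟨y, hy⟩ | ⟨y, hy⟩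
  · push_cast at hy
    obtain rfl : q = 3 * p - 5 * y := by linarith
    exact ⟨2 * p - 3 * y, y, by ring, by ring⟩
  · push_cast at hy
    obtain rfl : q = 5 * y - 3 * p := by linarith
    exact ⟨2 * p - 3 * y, y, by ring, by ring⟩

theorem IsSumThreeSq.exists_five_dvd {n s : ℤ} (h : IsSumThreeSq n) (hs : 5 ∣ n + s ^ 2) :
    ∃ X Y Z : ℤ, n = X ^ 2 + Y ^ 2 + Z ^ 2 ∧ 5 ∣ s ^ 2 + X ^ 2 := by
  have key : ∀ s X Y Z : ZMod 5, X ^ 2 + Y ^ 2 + Z ^ 2 + s ^ 2 = 0 →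
      s ^ 2 + X ^ 2 = 0 ∨ s ^ 2 + Y ^ 2 = 0 ∨ s ^ 2 + Z ^ 2 = 0 := by
    decide
  obtain ⟨X, Y, Z, rfl⟩ := h
  rw [← Nat.cast_ofNat, ← ZMod.intCast_zmod_eq_zero_iff_dvd] at hs
  push_cast at hs
  rcases key _ _ _ _ hs with h | h | h
  · exact ⟨X, Y, Z, rfl, (ZMod.intCast_zmod_eq_zero_iff_dvd _ 5).1 (by exact_mod_cast h)⟩
  · exact ⟨Y, X, Z, by ring, (ZMod.intCast_zmod_eq_zero_iff_dvd _ 5).1 (by exact_mod_cast h)⟩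
  · exact ⟨Z, X, Y, by ring, (ZMod.intCast_zmod_eq_zero_iff_dvd _ 5).1 (by exact_mod_cast h)⟩

theorem isSumFourSqWith_one_three_two_mul {n s : ℤ} (h : IsSumThreeSq (5 * n - s ^ 2)) :
    IsSumFourSqWith 1 3 0 (2 * s) (2 * n) := by
  obtain ⟨X, Y, Z, h, hX⟩ := h.exists_five_dvd (s := s) ⟨n, by ring⟩
  have hYZ : 5 ∣ Y ^ 2 + Z ^ 2 := by
    rw [show Y ^ 2 + Z ^ 2 = 5 * n - (s ^ 2 + X ^ 2) by linarith]
    exact (dvd_mul_right 5 n).sub hX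
  obtain ⟨x, y, hxy, hsX⟩ := exists_add_three_mul_eq_two_mul hX
  obtain ⟨z, w, -, hYZ⟩ := exists_add_three_mul_eq_two_mul hYZ
  exact ⟨x, y, z, w, by linarith, by linarith⟩

theorem isSumThreeSq_five_mul_or {n : ℕ} (hn : n % 8 ≠ 0) :
    IsSumThreeSq (5 * n) ∨ IsSumThreeSq (5 * n - 4) := by
  by_cases h4 : n % 4 = 0
  · obtain ⟨k, rfl⟩ := Nat.dvd_of_mod_eq_zero h4
    by_cases h3 : k % 8 = 3
    · right
      rw [show (5 * (4 * k : ℕ) - 4 : ℤ) = 4 ^ 1 * (5 * k - 1) by push_cast; ring]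
      exact isSumThreeSq_four_pow_mul 1 (by omega) (by omega) (by omega)
    · left
      rw [show (5 * (4 * k : ℕ) : ℤ) = 4 ^ 1 * (5 * k) by push_cast; ring]
      exact isSumThreeSq_four_pow_mul 1 (by omega) (by omega) (by omega)
  · by_cases h3 : n % 8 = 3
    · exact .inr (isSumThreeSq_of_emod_eight (by omega) (by omega) (by omega))
    · exact .inl (isSumThreeSq_of_emod_eight (by omega) (by omega) (by omega))

theorem exists_isSumFourSqWith_one_three_two_mul {n : ℕ} (hn : n % 8 ≠ 0) :
    ∃ t : ℤ, IsSumFourSqWith 1 3 0 (t ^ 2) (2 * n) := by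
  rcases isSumThreeSq_five_mul_or hn with h | h
  · exact ⟨0, isSumFourSqWith_one_three_two_mul (s := 0) (by simpa using h)⟩
  · exact ⟨2, isSumFourSqWith_one_three_two_mul (s := 2) (by simpa using h)⟩

theorem isSumFourSqWith_one_three_five {n r x y z : ℤ}
    (h : 7 * n = 7 * (x ^ 2 + 10 * y ^ 2) + (2 * z ^ 2 + 5 ^ 3 * r ^ 4)) :
    IsSumFourSqWith 1 3 5 ((5 * r) ^ 2) n := by
  obtain ⟨z', hz', v, hv⟩ : ∃ z' : ℤ, z' ^ 2 = z ^ 2 ∧ 7 ∣ 25 * r ^ 2 - 2 * z' := by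
    have hmul : (7 : ℤ) ∣ (25 * r ^ 2 - 2 * z) * (25 * r ^ 2 - 2 * -z) :=
      ⟨125 * r ^ 4 - 2 * (n - x ^ 2 - 10 * y ^ 2), by linear_combination 2 * h⟩
    rcases Int.Prime.dvd_mul' (p := 7) (by norm_num) hmul with h7 | h7
    · exact ⟨z, rfl, h7⟩
    · exact ⟨-z, neg_sq z, h7⟩
  obtain ⟨u, hu⟩ : 5 ∣ z' + v := by omega
  obtain rfl : z' = 5 * u - v := by linarith
  have hr : 5 * r ^ 2 = 2 * u + v := by linarith
  refine ⟨3 * y + u, 3 * u - y, v, x, ?_, by linarith⟩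
  refine mul_left_cancel₀ (by norm_num : (7 : ℤ) ≠ 0) ?_
  linear_combination h - 2 * hz' + 5 * (5 * r ^ 2 + 2 * u + v) * hr

/-! ### Finite checks -/

/-- Finite sets of natural numbers are encoded by binary digits: the digits `1` of
`bitSumset M l` mark the sums of a number marked by `M` and an entry of `l`. -/
def bitSumset (M : ℕ) (l : List ℕ) : ℕ :=
  l.foldr (fun a acc => (M <<< a) ||| acc) 0

theorem exists_testBit_of_testBit_bitSumset {M n : ℕ} {l : List ℕ}
    (h : (bitSumset M l).testBit n) : ∃ a ∈ l, ∃ k, M.testBit k ∧ n = k + a := by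
  induction l with
  | nil => simp [bitSumset] at h
  | cons a l ih =>
    rw [bitSumset, List.foldr_cons, Nat.testBit_or, Bool.or_eq_true, Nat.testBit_shiftLeft,
      Bool.and_eq_true, decide_eq_true_iff] at h
    rcases h with ⟨ha, hM⟩ | h
    · exact ⟨a, by simp, n - a, hM, by omega⟩
    · obtain ⟨b, hb, hk⟩ := ih h
      exact ⟨b, List.mem_cons_of_mem a hb, hk⟩

theorem testBit_of_mod_two_pow {M N n : ℕ} (h : M % 2 ^ N = 2 ^ N - 1) (hn : n < N) :
    M.testBit n := by
  simpa [Nat.testBit_mod_two_pow, Nat.testBit_two_pow_sub_one, hn] using congrArg (·.testBit n) h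

/-- The values of `x² + y²` at small integers `x`, `y` with `x + 3 y` a square. -/
def oneThreeValues : List ℕ :=
  (List.range 5).flatMap fun t => (List.range 16).map fun i =>
    let y : ℤ := i - 8
    ((t ^ 2 - 3 * y) ^ 2 + y ^ 2).toNat

/-- The values of `x² + y² + z²` at small integers `x`, `y`, `z` with `x + 3 y + 5 z` a square. -/
def oneThreeFiveValues : List ℕ :=
  (List.range 5).flatMap fun t => (List.range 41).flatMap fun i => (List.range 41).map fun j =>
    let y : ℤ := i - 20
    let z : ℤ := j - 20
    ((t ^ 2 - 3 * y - 5 * z) ^ 2 + y ^ 2 + z ^ 2).toNat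

theorem exists_of_mem_oneThreeValues {a : ℕ} (ha : a ∈ oneThreeValues) :
    ∃ t x y : ℤ, (a : ℤ) = x ^ 2 + y ^ 2 ∧ x + 3 * y = t ^ 2 := by
  simp only [oneThreeValues, List.mem_flatMap, List.mem_map] at ha
  obtain ⟨t, -, i, -, rfl⟩ := ha
  exact ⟨t, t ^ 2 - 3 * (i - 8), i - 8, Int.toNat_of_nonneg (by positivity), by ring⟩

theorem exists_of_mem_oneThreeFiveValues {a : ℕ} (ha : a ∈ oneThreeFiveValues) :
    ∃ t x y z : ℤ, (a : ℤ) = x ^ 2 + y ^ 2 + z ^ 2 ∧ x + 3 * y + 5 * z = t ^ 2 := by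
  simp only [oneThreeFiveValues, List.mem_flatMap, List.mem_map] at ha
  obtain ⟨t, -, i, -, j, -, rfl⟩ := ha
  exact ⟨t, t ^ 2 - 3 * (i - 20) - 5 * (j - 20), i - 20, j - 20,
    Int.toNat_of_nonneg (by positivity), by ring⟩

theorem bitSumset_oneThreeValues_mod :
    bitSumset (bitSumset (bitSumset 1 oneThreeValues) ((List.range 53).map (· ^ 2)))
      ((List.range 53).map (· ^ 2)) % 2 ^ 2720 = 2 ^ 2720 - 1 := by
  decide +kernel

theorem bitSumset_oneThreeFiveValues_mod :
    bitSumset (bitSumset 1 oneThreeFiveValues) ((List.range 35).map (· ^ 2)) % 2 ^ 1190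
      = 2 ^ 1190 - 1 := by
  decide +kernel

theorem exists_isSumFourSqWith_one_three_of_lt {n : ℕ} (hn : n < 2720) :
    ∃ t : ℤ, IsSumFourSqWith 1 3 0 (t ^ 2) n := by
  obtain ⟨w, hw, _, hsub, rfl⟩ := exists_testBit_of_testBit_bitSumset
    (testBit_of_mod_two_pow bitSumset_oneThreeValues_mod hn)
  obtain ⟨z, hz, _, hsub', rfl⟩ := exists_testBit_of_testBit_bitSumset hsub
  obtain ⟨a, ha, _, hzero, rfl⟩ := exists_testBit_of_testBit_bitSumset hsub'
  obtain rfl := Nat.testBit_one_eq_true_iff_self_eq_zero.1 hzero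
  obtain ⟨i, -, rfl⟩ := List.mem_map.1 hw
  obtain ⟨j, -, rfl⟩ := List.mem_map.1 hz
  obtain ⟨t, x, y, hxy, ht⟩ := exists_of_mem_oneThreeValues ha
  exact ⟨t, x, y, j, i, by push_cast; linarith, by linarith⟩

theorem exists_isSumFourSqWith_one_three_five_of_lt {n : ℕ} (hn : n < 1190) :
    ∃ t : ℤ, IsSumFourSqWith 1 3 5 (t ^ 2) n := by
  obtain ⟨w, hw, _, hsub, rfl⟩ := exists_testBit_of_testBit_bitSumset
    (testBit_of_mod_two_pow bitSumset_oneThreeFiveValues_mod hn)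
  obtain ⟨a, ha, _, hzero, rfl⟩ := exists_testBit_of_testBit_bitSumset hsub
  obtain rfl := Nat.testBit_one_eq_true_iff_self_eq_zero.1 hzero
  obtain ⟨i, -, rfl⟩ := List.mem_map.1 hw
  obtain ⟨t, x, y, z, hxyz, ht⟩ := exists_of_mem_oneThreeFiveValues ha
  exact ⟨t, x, y, z, i, by push_cast; linarith, by linarith⟩

theorem exists_isSumFourSqWith_one_three
    (H : ∀ n : ℤ, Odd n → 2719 < n → ∃ x y z : ℤ, n = x ^ 2 + y ^ 2 + 10 * z ^ 2) (n : ℕ) :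
    ∃ t : ℤ, IsSumFourSqWith 1 3 0 (t ^ 2) n := by
  refine exists_isSumFourSqWith_sq_of_not_dvd (fun n hn => ?_) n
  rcases n.even_or_odd' with ⟨k, rfl | rfl⟩
  · simpa using exists_isSumFourSqWith_one_three_two_mul (n := k) (by omega)
  rcases lt_or_ge (2 * k + 1) 2720 with hlt | hge
  · exact exists_isSumFourSqWith_one_three_of_lt hlt
  · obtain ⟨x, y, z, h⟩ := H (2 * k + 1 : ℕ) (by simp) (by omega)
    exact ⟨0, 3 * z, -z, x, y, by linarith, by ring⟩

theorem exists_isSumFourSqWith_one_three_five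
    (H : ∀ n : ℤ, 1190 ≤ n → ¬ 16 ∣ n → ∃ r x y z : ℤ, (n : ℚ) = (x : ℚ) ^ 2 + 10 * (y : ℚ) ^ 2
      + (2 * (z : ℚ) ^ 2 + 5 ^ 3 * (r : ℚ) ^ 4) / 7) (n : ℕ) :
    ∃ t : ℤ, IsSumFourSqWith 1 3 5 (t ^ 2) n := by
  refine exists_isSumFourSqWith_sq_of_not_dvd (fun n hn => ?_) n
  rcases lt_or_ge n 1190 with hlt | hge
  · exact exists_isSumFourSqWith_one_three_five_of_lt hlt
  · obtain ⟨r, x, y, z, h⟩ := H n (by omega) (by omega)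
    refine ⟨5 * r, isSumFourSqWith_one_three_five (x := x) (y := y) (z := z) ?_⟩
    have h7 : (7 * n : ℚ) = 7 * (x ^ 2 + 10 * y ^ 2) + (2 * z ^ 2 + 5 ^ 3 * r ^ 4) := by
      push_cast at h
      rw [h]
      ring
    exact_mod_cast h7

theorem theorem1p3_general :
    (∀ m : ℕ, m ∈ ({2, 3} : Set ℕ) → ∀ c d : ℤ, (c, d) ∈ admissiblePairs m →
      ∀ n : ℕ, ∃ x y z w : ℤ,
        (n : ℤ) = x ^ 2 + y ^ 2 + z ^ 2 + w ^ 2 ∧ ∃ t : ℤ, x + y + c * z = d * t ^ m) ∧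
    ((∀ n : ℤ, Odd n → 2719 < n → ∃ x y z : ℤ, n = x ^ 2 + y ^ 2 + 10 * z ^ 2) →
      ∀ n : ℕ, ∃ x y z w : ℤ,
        (n : ℤ) = x ^ 2 + y ^ 2 + z ^ 2 + w ^ 2 ∧ IsSquare (x + 3 * y)) ∧
    ((∀ n : ℤ, 1190 ≤ n → ¬ (16 ∣ n) → ∃ r x y z : ℤ,
        (n : ℚ) = (x : ℚ) ^ 2 + 10 * (y : ℚ) ^ 2
          + (2 * (z : ℚ) ^ 2 + 5 ^ 3 * (r : ℚ) ^ 4) / 7) →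
      ∀ n : ℕ, ∃ x y z w : ℤ,
        (n : ℤ) = x ^ 2 + y ^ 2 + z ^ 2 + w ^ 2 ∧ IsSquare (x + 3 * y + 5 * z)) := by
  refine ⟨fun m hm c d hcd n => ?_, fun H n => ?_, fun H n => ?_⟩
  · obtain ⟨t, x, y, z, w, hn, ht⟩ := exists_isSumFourSqWith_of_mem_admissiblePairs hm hcd n
    exact ⟨x, y, z, w, hn, t, by linarith⟩
  · obtain ⟨t, x, y, z, w, hn, ht⟩ := exists_isSumFourSqWith_one_three H n
    exact ⟨x, y, z, w, hn, t, by linarith⟩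
  · obtain ⟨t, x, y, z, w, hn, ht⟩ := exists_isSumFourSqWith_one_three_five H n
    exact ⟨x, y, z, w, hn, t, by linarith⟩

theorem theorem1p3 :
    -- part (i)
    (∀ m : ℕ, m ∈ ({2, 3} : Set ℕ) → ∀ c d : ℤ, (c, d) ∈ admissiblePairs m →
      ∀ n : ℕ, ∃ x y z w : ℤ,
        (n : ℤ) = x ^ 2 + y ^ 2 + z ^ 2 + w ^ 2 ∧ ∃ t : ℤ, x + y + c * z = d * t ^ m) ∧
    -- part (ii)
    ((∀ n : ℤ, Odd n → 2719 < n → ∃ x y z : ℤ, n = x ^ 2 + y ^ 2 + 10 * z ^ 2) →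
      ∀ n : ℕ, ∃ x y z w : ℤ,
        (n : ℤ) = x ^ 2 + y ^ 2 + z ^ 2 + w ^ 2 ∧ IsSquare (x + 3 * y)) ∧
    -- part (iii); the quotient by 7 is taken in the rational numbers
    ((∀ n : ℤ, 1190 ≤ n → ¬ (16 ∣ n) → ∃ r ∈ ({0, 1, 2, 3} : Set ℤ), ∃ x y z : ℤ,
        (n : ℚ) = (x : ℚ) ^ 2 + 10 * (y : ℚ) ^ 2
          + (2 * (z : ℚ) ^ 2 + 5 ^ 3 * (r : ℚ) ^ 4) / 7) →
      ∀ n : ℕ, ∃ x y z w : ℤ,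
        (n : ℤ) = x ^ 2 + y ^ 2 + z ^ 2 + w ^ 2 ∧ IsSquare (x + 3 * y + 5 * z)) := by
  obtain ⟨hi, hii, hiii⟩ := theorem1p3_general
  exact ⟨hi, hii, fun H => hiii fun n hn h16 => (H n hn h16).imp fun _ => And.right⟩
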